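/- Let $N\ge 1$, and let $\Phi=(\Phi_{ij})_{i,j\ge 0}$ be a nearest-neighbour quantum Markov chain on $\mathbb{Z}_{\ge 0}$ with internal space $\mathbb{C}^N$: each $\Phi_{ij}$ is a completely positive map on $M_N(\mathbb{C})$, $\Phi_{ij}=0$ for $|i-j|>1$, every column sum $\sum_i\Phi_{ij}$ is trace preserving, and $\Phi$ acts on trace-class block diagonal operators $X=(X_i)_{i\ge 0}$ by $\Phi(X)_i=\sum_j\Phi_{ij}(X_j)$. The chain is irreducible if the only orthogonal projections $P=(P_i)_{i\ge 0}$ for which $\Phi$ maps every operator $PXP$ ($X$ trace class) to an operator of the form $PYP$ are $P=0$ and $P=I$; it is positive recurrent if it is irreducible and there is a density $\rho=(\rho_i)_{i\ge0}$ ($\rho_i\ge 0$, $\sum_i\operatorname{Tr}\rho_i=1$) with $\Phi(\rho)=\rho$. Write $A_n,B_n,C_{n+1}\in M_{N^2}(\mathbb{C})$ for the matrices, in the basis of matrix units, of $\Phi_{n+1,n},\Phi_{n,n},\Phi_{n,n+1}$, and suppose that all $A_n$ are nonsingular. Let $Q_n$ be the matrix polynomials given by $Q_{-1}=0$, $Q_0=I$,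 $xQ_n(x)=Q_{n+1}(x)A_n+Q_n(x)B_n+Q_{n-1}(x)C_n$. A weight matrix of $\Phi$ is an $N^2\times N^2$ matrix $W$ of complex measures on $\mathbb{R}$, positive semidefinite on every Borel set and with finite moments, such that $\int_{\mathbb{R}} Q_i^*(x)\,dW(x)\,Q_j(x)$ is $0$ for $i\ne j$ and nonsingular for $i=j$. Suppose that $\Phi$ is irreducible and that $W$ is a weight matrix of $\Phi$. Then $\Phi$ is positive recurrent if and only if $W$ has a jump at $x=1$, that is, $W(\{1\})\neq 0$. Moreover, $W$ can have a jump at $x=-1$ only if it has a jump at $x=1$. -/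

import Mathlib

open MeasureTheory
open scoped ComplexOrder MatrixOrder Matrix.Norms.L2Operator CStarAlgebra

/-- The operators on the internal space `ℂ^N`. They carry the operator norm and the order given by
positive semidefiniteness. -/
abbrev Op (N : ℕ) : Type := Matrix (Fin N) (Fin N) ℂ

/-- The `N² × N²` complex matrices, with rows and columns indexed by the pairs `(a, b)`, i.e. by the
entries of an `N × N` matrix. -/
abbrev SuperOp (N : ℕ) : Type := Matrix (Fin N × Fin N) (Fin N × Fin N) ℂ

/-- A quantum Markov chain on the set of sites `V` with internal space `ℂ^N`: a family of completely
positive maps `Φ_{ij}` (the transition from site `j` to site `i`) whose column sums `∑_i Φ_{ij}` are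
trace preserving. -/
structure QMC (V : Type*) (N : ℕ) where
  map : V → V → (Op N →CP Op N)
  hasSum_trace : ∀ (j : V) (X : Op N), HasSum (fun i => (map i j X).trace) X.trace

namespace QMC

/-- The trace class block diagonal operators `∑_i X_i ⊗ |i⟩⟨i|`. As the blocks have a fixed finite
size, summability of the operator norms is the same as summability of the trace norms. -/
def IsTraceClass {V : Type*} {N : ℕ} (X : V → Op N) : Prop :=
  Summable fun i => ‖X i‖

/-- The densities: positive semidefinite blocks whose traces sum to one. -/
def IsDensity {V : Type*} {N : ℕ} (ρ : V → Op N) : Prop :=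
  (∀ i, (ρ i).PosSemidef) ∧ HasSum (fun i => (ρ i).trace) 1

/-- One time step: `Φ(X)_i = ∑_j Φ_{ij}(X_j)`. -/
noncomputable def evolve {V : Type*} {N : ℕ} (Φ : QMC V N) (X : V → Op N) : V → Op N :=
  fun i => ∑' j, Φ.map i j (X j)

/-- Irreducibility: the only orthogonal projections `P = ∑_i P_i ⊗ |i⟩⟨i|` such that `Φ` maps every
`P X P`, with `X` trace class, to an operator of the form `P Y P` (equivalently, to an operator that
equals its own compression by `P`) are `0` and the identity. -/
def IsIrreducible {V : Type*} {N : ℕ} (Φ : QMC V N) : Prop :=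
  ∀ P : V → Op N, (∀ i, IsStarProjection (P i)) →
    (∀ X : V → Op N, IsTraceClass X → ∀ i,
      P i * Φ.evolve (fun j => P j * X j * P j) i * P i = Φ.evolve (fun j => P j * X j * P j) i) →
    (∀ i, P i = 0) ∨ (∀ i, P i = 1)

/-- Positive recurrence: irreducibility together with the existence of an invariant density. -/
def IsPositiveRecurrent {V : Type*} {N : ℕ} (Φ : QMC V N) : Prop :=
  Φ.IsIrreducible ∧ ∃ ρ : V → Op N, IsDensity ρ ∧ Φ.evolve ρ = ρ

/-- Nearest-neighbour chains on the half-line: transitions only change the site by at most one. -/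
def IsNearestNeighbour {N : ℕ} (Φ : QMC ℕ N) : Prop :=
  ∀ i j : ℕ, i ≠ j → i ≠ j + 1 → j ≠ i + 1 → ∀ X, Φ.map i j X = 0

/-- The matrix of `Φ_{ij}` in the basis of matrix units, so that it sends the vector
`vec(X) = (X_{ab})_{(a,b)}` to `vec(Φ_{ij}(X))`. -/
noncomputable def blockMatrix {V : Type*} {N : ℕ} (Φ : QMC V N) (i j : V) : SuperOp N :=
  Matrix.of fun p q => Φ.map i j (Matrix.single q.1 q.2 1) p.1 p.2

/-- The matrix polynomials of a nearest-neighbour chain on the half-line, as functions of a real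
variable: with `A_n = Φ_{n+1,n}`, `B_n = Φ_{n,n}`, `C_n = Φ_{n-1,n}`,
`x Q_n(x) = Q_{n+1}(x) A_n + Q_n(x) B_n + Q_{n-1}(x) C_n`, `Q_0 = I`, `Q_{-1} = 0`.
The recurrence determines them when all `A_n` are nonsingular. -/
noncomputable def Q {N : ℕ} (Φ : QMC ℕ N) : ℕ → ℝ → SuperOp N
  | 0, _ => 1
  | 1, x => (x • 1 - Φ.blockMatrix 0 0) * (Φ.blockMatrix 1 0)⁻¹
  | n + 2, x =>
      (x • Φ.Q (n + 1) x - Φ.Q (n + 1) x * Φ.blockMatrix (n + 1) (n + 1)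
        - Φ.Q n x * Φ.blockMatrix n (n + 1)) * (Φ.blockMatrix (n + 2) (n + 1))⁻¹

end QMC

/-- A weight matrix of size `N²`: a countably additive matrix-valued set function on the Borel sets
of the real line, with positive semidefinite values and finite moments of every order. -/
structure WeightMatrix (N : ℕ) where
  measure : VectorMeasure ℝ (SuperOp N)
  posSemidef : ∀ s, MeasurableSet s → (measure s).PosSemidef
  integrable_pow : ∀ n : ℕ, measure.Integrable fun x : ℝ => x ^ n

namespace WeightMatrix

/-- The matrix-valued inner product `(P, Q) = ∫ P(x)^* dW(x) Q(x)`. -/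
noncomputable def innerProduct {N : ℕ} (W : WeightMatrix N) (P Q : ℝ → SuperOp N) : SuperOp N :=
  W.measure.integral (fun x => ContinuousLinearMap.mulLeftRight ℝ (SuperOp N) (P x).conjTranspose (Q x))
    (ContinuousLinearMap.id ℝ (SuperOp N →L[ℝ] SuperOp N))

/-- `W` is a weight matrix of the chain `Φ`: the polynomials `Q_n` are well defined (with
nonsingular leading coefficients), and they are orthogonal for `W`, with nonsingular norms. -/
structure IsWeightOf {N : ℕ} (W : WeightMatrix N) (Φ : QMC ℕ N) : Prop where
  isUnit_up : ∀ n, IsUnit (Φ.blockMatrix (n + 1) n)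
  orthogonal : ∀ i j, i ≠ j → W.innerProduct (Φ.Q i) (Φ.Q j) = 0
  isUnit_norm : ∀ i, IsUnit (W.innerProduct (Φ.Q i) (Φ.Q i))

/-- `W` has a jump at `x`: the positive semidefinite matrix `W({x})` is not zero. -/
def HasJumpAt {N : ℕ} (W : WeightMatrix N) (x : ℝ) : Prop :=
  W.measure {x} ≠ 0

end WeightMatrix

/-!
The chain is compared with multiplication by `x` on matrix polynomials. The recurrence for the
`Q_n` says that `x^n Q_j = ∑_i Q_i (Φ^n)_{ij}`, so orthogonality identifies the powers of the chain
with the moments of `W`: if `F_i` denotes the norm of `Q_i`, then `(Q_i, x^n Q_j) = F_i (Φ^n)_{ij}`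
(`WeightMatrix.IsWeightOf.innerProduct_pow`).

Complete positivity and trace preservation bound the blocks `(Φ^n)_{ij}` uniformly in `n`. Hence `W`
has bounded moments and lives on `[-1, 1]` (`WeightMatrix.IsWeightOf.ae_abs_le_one`). On `[-1, 1]`
the functions `((s x)^n + (s x)^{n+1}) / 2`, for `s = ±1`, are bounded and converge to the indicator
of `{s}`. By dominated convergence the averages `(s^n (Φ^n)_{ij} + s^{n+1} (Φ^{n+1})_{ij}) / 2`
converge to `F_i⁻¹ Q_i(s)^* W({s}) Q_j(s)` (`WeightMatrix.IsWeightOf.tendsto_power`). The three claims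
follow.

* An invariant density `ρ` satisfies `ρ_i = ∑_j (Φ^n)_{ij} ρ_j` for every `n`, with traces dominated
  by the summable traces of the `ρ_j`. Without a jump at `1` the averages over two consecutive `n`
  would tend to zero, and `ρ` would vanish.
* With a jump at `1`, the limit of the averages of `(Φ^n)_{i0}` does not vanish for `i = 0`. Its value
  at a suitable positive operator is a nonzero invariant positive trace class operator.
* If there were a jump at `-1` but none at `1`, the positive maps `(Φ^{2n})_{00}` and
  `(Φ^{2n+1})_{00}` would have opposite nonzero limits, which is impossible for positive maps.
-/

open Filter Topology

/-! ### Positive operators and matrices of superoperators -/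

theorem Matrix.PosSemidef.norm_le_re_trace {n : Type*} [Fintype n] [DecidableEq n]
    {A : Matrix n n ℂ} (hA : A.PosSemidef) : ‖A‖ ≤ A.trace.re := by
  have htr : A.trace.re = ∑ i, hA.1.eigenvalues i := by
    rw [hA.1.trace_eq_sum_eigenvalues]; simp
  have h0 : 0 ≤ A.trace.re := by
    rw [htr]; exact Finset.sum_nonneg fun i _ => hA.eigenvalues_nonneg i
  rw [CStarAlgebra.norm_le_iff_le_algebraMap A h0 (Matrix.nonneg_iff_posSemidef.2 hA),
    le_algebraMap_iff_spectrum_le (ha := hA.1.isSelfAdjoint)]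
  intro x hx
  rw [hA.1.spectrum_real_eq_range_eigenvalues] at hx
  obtain ⟨i, rfl⟩ := hx
  rw [htr]
  exact Finset.single_le_sum (fun i _ => hA.eigenvalues_nonneg i) (Finset.mem_univ i)

/-- The algebra isomorphism taking a linear map on `M_N(ℂ)` to its matrix in the basis of matrix
units. -/
noncomputable def superMatrix (N : ℕ) : Module.End ℂ (Op N) ≃ₐ[ℂ] SuperOp N :=
  LinearMap.toMatrixAlgEquiv (Matrix.stdBasis ℂ (Fin N) (Fin N))

theorem superMatrix_apply {N : ℕ} (f : Module.End ℂ (Op N)) (p q : Fin N × Fin N) :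
    superMatrix N f p q = f (Matrix.single q.1 q.2 1) p.1 p.2 := by
  obtain ⟨a, b⟩ := q
  simp only [superMatrix, LinearMap.toMatrixAlgEquiv_apply, Matrix.stdBasis_eq_single]
  rfl

/-- A linear map is determined by its values on positive operators. -/
theorem LinearMap.eq_zero_of_nonneg {N : ℕ} {f : Module.End ℂ (Op N)}
    (h : ∀ X : Op N, 0 ≤ X → f X = 0) : f = 0 := by
  have : (⊤ : Submodule ℂ (Op N)) ≤ LinearMap.ker f := by
    rw [← CStarAlgebra.span_nonneg, Submodule.span_le]
    exact fun X hX => h X hX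
  exact LinearMap.ker_eq_top.1 (top_le_iff.1 this)

theorem tendsto_superMatrix_symm_apply {N : ℕ} {ι : Type*} {l : Filter ι} {M : ι → SuperOp N}
    {R : SuperOp N} (h : Tendsto M l (𝓝 R)) (X : Op N) :
    Tendsto (fun n => (superMatrix N).symm (M n) X) l (𝓝 ((superMatrix N).symm R X)) := by
  have hc : Continuous fun M : SuperOp N => (superMatrix N).symm M X :=
    ((LinearMap.applyₗ X).comp
      ((superMatrix N).symm.toLinearEquiv.toLinearMap)).continuous_of_finiteDimensional
  exact (hc.tendsto R).comp h

/-- A sequence of linear maps which is bounded on every positive operator has bounded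
matrices. -/
theorem exists_norm_superMatrix_le {N : ℕ} (f : ℕ → Module.End ℂ (Op N))
    (h : ∀ X : Op N, 0 ≤ X → ∃ C : ℝ, ∀ n, ‖f n X‖ ≤ C) :
    ∃ C : ℝ, ∀ n, ‖superMatrix N (f n)‖ ≤ C := by
  have hall : ∀ X : Op N, ∃ C : ℝ, ∀ n, ‖f n X‖ ≤ C := by
    intro X
    have hX : X ∈ Submodule.span ℂ {A : Op N | 0 ≤ A} := by
      rw [CStarAlgebra.span_nonneg]; trivial
    induction hX using Submodule.span_induction with
    | mem X hX => exact h X hX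
    | zero => exact ⟨0, fun n => by simp⟩
    | add X Y _ _ hX hY =>
      obtain ⟨C, hC⟩ := hX
      obtain ⟨D, hD⟩ := hY
      refine ⟨C + D, fun n => ?_⟩
      rw [map_add]
      exact (norm_add_le _ _).trans (add_le_add (hC n) (hD n))
    | smul c X _ hX =>
      obtain ⟨C, hC⟩ := hX
      refine ⟨‖c‖ * C, fun n => ?_⟩
      rw [map_smul, norm_smul]
      exact mul_le_mul_of_nonneg_left (hC n) (norm_nonneg c)
  -- The uniform boundedness principle, followed by the continuity of the matrix representation.
  obtain ⟨C, hC⟩ := banach_steinhaus (g := fun n => LinearMap.toContinuousLinearMap (f n)) hall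
  let L : (Op N →L[ℂ] Op N) →L[ℂ] SuperOp N := LinearMap.toContinuousLinearMap
    ((superMatrix N).toLinearEquiv.toLinearMap ∘ₗ
      (LinearMap.toContinuousLinearMap (𝕜 := ℂ) (E := Op N) (F' := Op N)).symm.toLinearMap)
  refine ⟨‖L‖ * C, fun n => ?_⟩
  have hL : superMatrix N (f n) = L (LinearMap.toContinuousLinearMap (f n)) := by
    simp [L]
  rw [hL]
  exact (L.le_opNorm _).trans (mul_le_mul_of_nonneg_left (hC n) (norm_nonneg L))

namespace QMC

variable {N : ℕ} {Φ : QMC ℕ N}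

/-! ### Powers of a nearest-neighbour chain -/

/-- The transition `Φ_{ij}` as a linear map. -/
noncomputable def toEnd {V : Type*} (Φ : QMC V N) (i j : V) : Module.End ℂ (Op N) :=
  (Φ.map i j).toLinearMap

theorem toEnd_apply {V : Type*} (Φ : QMC V N) (i j : V) (X : Op N) :
    Φ.toEnd i j X = Φ.map i j X := rfl

theorem superMatrix_toEnd {V : Type*} (Φ : QMC V N) (i j : V) :
    superMatrix N (Φ.toEnd i j) = Φ.blockMatrix i j := by
  ext p q
  rw [superMatrix_apply]
  rfl

theorem toEnd_nonneg {V : Type*} (Φ : QMC V N) (i j : V) {X : Op N} (hX : 0 ≤ X) :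
    0 ≤ Φ.toEnd i j X :=
  map_nonneg (Φ.map i j) hX

theorem IsNearestNeighbour.toEnd_eq_zero (hΦ : Φ.IsNearestNeighbour) {i j : ℕ}
    (h : i + 1 < j ∨ j + 1 < i) : Φ.toEnd i j = 0 :=
  LinearMap.ext fun X => hΦ i j (by omega) (by omega) (by omega) X

/-- The blocks `(Φ^n)_{ij}` of the powers of a nearest-neighbour chain on the half-line: only the
sites `k ≤ i + 1` can be left towards `i`, hence the finite range. -/
noncomputable def power (Φ : QMC ℕ N) : ℕ → ℕ → ℕ → Module.End ℂ (Op N)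
  | 0, i, j => if i = j then 1 else 0
  | n + 1, i, j => ∑ k ∈ Finset.range (i + 2), Φ.toEnd i k * Φ.power n k j

theorem power_eq_zero (hΦ : Φ.IsNearestNeighbour) {n i j : ℕ} (h : i + n < j ∨ j + n < i) :
    Φ.power n i j = 0 := by
  induction n generalizing i with
  | zero => simp only [power]; rw [if_neg (by omega)]
  | succ n ih =>
    rw [power]
    refine Finset.sum_eq_zero fun k hk => ?_
    rw [Finset.mem_range] at hk
    by_cases hki : k + 1 < i
    · rw [hΦ.toEnd_eq_zero (Or.inr hki), zero_mul]
    · rw [ih (by omega), mul_zero]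

/-- In the product defining `Φ^{n+1}`, the sum may be taken over any initial segment of the sites
that is long enough for either of the two factors. -/
theorem power_succ (hΦ : Φ.IsNearestNeighbour) {n i j L : ℕ} (hL : i + 1 < L ∨ j + n < L) :
    Φ.power (n + 1) i j = ∑ k ∈ Finset.range L, Φ.toEnd i k * Φ.power n k j := by
  have hzero : ∀ k, i + 2 ≤ k ∨ L ≤ k → i + 2 ≤ k ∨ j + n < k →
      Φ.toEnd i k * Φ.power n k j = 0 := by
    rintro k - (hk | hk)
    · rw [hΦ.toEnd_eq_zero (Or.inl (by omega)), zero_mul]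
    · rw [power_eq_zero hΦ (Or.inr hk), mul_zero]
  rw [power]
  rcases le_total (i + 2) L with hle | hle
  · refine Finset.sum_subset (Finset.range_mono hle) fun k _ hk => ?_
    rw [Finset.mem_range, not_lt] at hk
    exact hzero k (Or.inl hk) (Or.inl hk)
  · refine (Finset.sum_subset (Finset.range_mono hle) fun k _ hk => ?_).symm
    rw [Finset.mem_range, not_lt] at hk
    exact hzero k (Or.inr hk) (by omega)

theorem power_nonneg (n i j : ℕ) {X : Op N} (hX : 0 ≤ X) : 0 ≤ Φ.power n i j X := by
  induction n generalizing i with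
  | zero =>
    rw [power]
    split_ifs
    · exact hX
    · exact le_rfl
  | succ n ih =>
    rw [power, LinearMap.sum_apply]
    exact Finset.sum_nonneg fun k _ => Φ.toEnd_nonneg i k (ih k)

theorem sum_trace_toEnd (hΦ : Φ.IsNearestNeighbour) {j L : ℕ} (hL : j + 1 < L) (X : Op N) :
    ∑ i ∈ Finset.range L, (Φ.toEnd i j X).trace = X.trace := by
  refine (hasSum_sum_of_ne_finset_zero fun i hi => ?_).unique (Φ.hasSum_trace j X)
  rw [Finset.mem_range, not_lt] at hi
  rw [hΦ.toEnd_eq_zero (Or.inr (by omega))]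
  simp

theorem sum_trace_power (hΦ : Φ.IsNearestNeighbour) {n j L : ℕ} (hL : j + n < L) (X : Op N) :
    ∑ i ∈ Finset.range L, (Φ.power n i j X).trace = X.trace := by
  induction n generalizing L with
  | zero =>
    rw [Finset.sum_eq_single_of_mem j (Finset.mem_range.2 hL)]
    · simp [power]
    · intro i _ hij
      simp [power, hij]
  | succ n ih =>
    have hstep : ∀ i, (Φ.power (n + 1) i j X).trace =
        ∑ k ∈ Finset.range (j + n + 1), (Φ.toEnd i k (Φ.power n k j X)).trace := by
      intro i
      rw [power_succ hΦ (n := n) (j := j) (L := j + n + 1) (Or.inr (by omega)), LinearMap.sum_apply,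
        Matrix.trace_sum]
      rfl
    simp_rw [hstep]
    rw [Finset.sum_comm, ← ih (L := j + n + 1) (by omega)]
    refine Finset.sum_congr rfl fun k hk => ?_
    rw [Finset.mem_range] at hk
    exact sum_trace_toEnd hΦ (by omega) _

theorem sum_trace_power_le (hΦ : Φ.IsNearestNeighbour) (n j : ℕ) (s : Finset ℕ) {X : Op N}
    (hX : 0 ≤ X) : ∑ i ∈ s, (Φ.power n i j X).trace ≤ X.trace := by
  obtain ⟨L, hL⟩ := s.exists_nat_subset_range
  rw [← sum_trace_power hΦ (n := n) (j := j) (L := max L (j + n + 1)) (by omega) X]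
  refine Finset.sum_le_sum_of_subset_of_nonneg
    (hL.trans (Finset.range_mono (le_max_left _ _))) fun i _ _ => ?_
  exact (Matrix.nonneg_iff_posSemidef.1 (power_nonneg n i j hX)).trace_nonneg

theorem trace_power_le (hΦ : Φ.IsNearestNeighbour) (n i j : ℕ) {X : Op N} (hX : 0 ≤ X) :
    (Φ.power n i j X).trace ≤ X.trace := by
  simpa using sum_trace_power_le hΦ n j {i} hX

/-- The blocks of the powers of a chain are uniformly bounded. -/
theorem exists_norm_power_le (hΦ : Φ.IsNearestNeighbour) (i j : ℕ) :
    ∃ C : ℝ, ∀ n, ‖superMatrix N (Φ.power n i j)‖ ≤ C := by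
  refine exists_norm_superMatrix_le _ fun X hX => ⟨X.trace.re, fun n => ?_⟩
  exact (Matrix.nonneg_iff_posSemidef.1 (power_nonneg n i j hX)).norm_le_re_trace.trans
    (Complex.le_def.1 (trace_power_le hΦ n i j hX)).1

theorem evolve_eq_sum (hΦ : Φ.IsNearestNeighbour) (X : ℕ → Op N) {i L : ℕ} (hL : i + 1 < L) :
    Φ.evolve X i = ∑ k ∈ Finset.range L, Φ.toEnd i k (X k) := by
  refine tsum_eq_sum fun k hk => ?_
  rw [Finset.mem_range, not_lt] at hk
  rw [← toEnd_apply, hΦ.toEnd_eq_zero (Or.inl (by omega)), LinearMap.zero_apply]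

theorem sum_power_of_evolve_eq (hΦ : Φ.IsNearestNeighbour) {X : ℕ → Op N} (hX : Φ.evolve X = X)
    {n i L : ℕ} (hL : i + n < L) : ∑ j ∈ Finset.range L, Φ.power n i j (X j) = X i := by
  induction n generalizing i with
  | zero =>
    rw [Finset.sum_eq_single_of_mem i (Finset.mem_range.2 hL)]
    · simp [power]
    · intro j _ hij
      simp [power, hij.symm]
  | succ n ih =>
    calc ∑ j ∈ Finset.range L, Φ.power (n + 1) i j (X j)
        = ∑ j ∈ Finset.range L, ∑ k ∈ Finset.range (i + 2),
            Φ.toEnd i k (Φ.power n k j (X j)) := by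
          refine Finset.sum_congr rfl fun j _ => ?_
          rw [power, LinearMap.sum_apply]
          rfl
      _ = ∑ k ∈ Finset.range (i + 2), Φ.toEnd i k (X k) := by
          rw [Finset.sum_comm]
          refine Finset.sum_congr rfl fun k hk => ?_
          rw [Finset.mem_range] at hk
          rw [← map_sum, ih (by omega)]
      _ = X i := by rw [← evolve_eq_sum hΦ X (by omega), hX]

end QMC

/-! ### Integration against a vector measure -/

/-- Continuous linear maps commute with integrals against a vector measure, where the pairing and
the integrand may be changed at the same time. -/
theorem MeasureTheory.VectorMeasure.clm_apply_integral {X E E' F G G' : Type*} [MeasurableSpace X]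
    [NormedAddCommGroup E] [NormedSpace ℝ E] [NormedAddCommGroup E'] [NormedSpace ℝ E']
    [NormedAddCommGroup F] [NormedSpace ℝ F] [NormedAddCommGroup G] [NormedSpace ℝ G]
    [NormedAddCommGroup G'] [NormedSpace ℝ G'] [CompleteSpace G] [CompleteSpace G']
    (μ : VectorMeasure X F) {B : E →L[ℝ] F →L[ℝ] G} {B' : E' →L[ℝ] F →L[ℝ] G'}
    (u : E →L[ℝ] E') (L : G →L[ℝ] G') (h : ∀ e v, L (B e v) = B' (u e) v) {f : X → E}
    (hf : μ.Integrable f) :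
    L (μ.integral f B) = μ.integral (fun x => u (f x)) B' := by
  revert hf
  refine Integrable.induction
    (fun f : X → E => L (μ.integral f B) = μ.integral (fun x => u (f x)) B') ?_ ?_ ?_ ?_ (f := f)
  · intro c s hs hμs
    have hu : (fun x => u (s.indicator (fun _ => c) x)) = s.indicator fun _ => u c :=
      (Set.indicator_comp_of_zero (f := fun _ : X => c) (_root_.map_zero u)).symm
    simp only [hu]
    rw [VectorMeasure.integral, VectorMeasure.integral, setToFun_indicator_const _ hs hμs.ne,
      setToFun_indicator_const _ hs hμs.ne]
    exact h c (μ s)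
  · intro f g _ hf hg ihf ihg
    have hu : (fun x => u ((f + g) x)) = fun x => u (f x) + u (g x) :=
      funext fun x => _root_.map_add u (f x) (g x)
    rw [hu, VectorMeasure.integral_fun_add (u.integrable_comp hf) (u.integrable_comp hg),
      ← ihf, ← ihg, ← _root_.map_add, ← VectorMeasure.integral_fun_add hf hg]
    rfl
  · have hu : ∀ f : X →₁[μ.variation] E,
        μ.integral (fun x => u (f x)) B' = μ.integral (u.compLp f) B' := fun f =>
      VectorMeasure.integral_congr_ae (u.coeFn_compLp' f).symm
    simp only [hu]
    exact isClosed_eq (L.continuous.comp VectorMeasure.continuous_integral)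
      (VectorMeasure.continuous_integral.comp (u.compLpL 1 μ.variation).continuous)
  · intro f g hfg _ ih
    rw [← VectorMeasure.integral_congr_ae hfg, ih]
    exact VectorMeasure.integral_congr_ae (hfg.fun_comp u)

namespace WeightMatrix

variable {N : ℕ} (W : WeightMatrix N)

instance : IsFiniteMeasure W.measure.variation := by
  have h := W.integrable_pow 0
  simp only [pow_zero] at h
  exact (integrable_const_iff_isFiniteMeasure one_ne_zero).1 h

theorem integrable_of_hasTemperateGrowth {E : Type*} [NormedAddCommGroup E] [NormedSpace ℝ E]
    {f : ℝ → E} (hf : f.HasTemperateGrowth) : W.measure.Integrable f := by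
  obtain ⟨k, C, hC⟩ := hf.2 0
  have hint : Integrable (fun x : ℝ => C * (2 ^ (k - 1) * (1 ^ k + ‖x ^ k‖)))
      W.measure.variation :=
    (((integrable_const _).add (W.integrable_pow k).norm).const_mul _).const_mul _
  have hC0 : 0 ≤ C := by
    simpa using (norm_nonneg _).trans (hC 0)
  refine hint.mono' hf.1.continuous.aestronglyMeasurable (Eventually.of_forall fun x => ?_)
  rw [← norm_iteratedFDeriv_zero (𝕜 := ℝ), norm_pow]
  exact (hC x).trans (mul_le_mul_of_nonneg_left
    (add_pow_le zero_le_one (norm_nonneg x) k) hC0)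

theorem integrable_mulLeftRight {P Q : ℝ → SuperOp N} (hP : P.HasTemperateGrowth)
    (hQ : Q.HasTemperateGrowth) :
    W.measure.Integrable fun x =>
      ContinuousLinearMap.mulLeftRight ℝ (SuperOp N) (P x).conjTranspose (Q x) := by
  have hstar : Function.HasTemperateGrowth fun x => (P x).conjTranspose :=
    ((starL' ℝ : SuperOp N ≃L[ℝ] SuperOp N) : SuperOp N →L[ℝ] SuperOp N).hasTemperateGrowth.comp hP
  exact W.integrable_of_hasTemperateGrowth
    ((ContinuousLinearMap.mulLeftRight ℝ (SuperOp N)).bilinear_hasTemperateGrowth hstar hQ)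

theorem innerProduct_mul {P Q : ℝ → SuperOp N} (M : SuperOp N) (hP : P.HasTemperateGrowth)
    (hQ : Q.HasTemperateGrowth) :
    W.innerProduct P (fun x => Q x * M) = W.innerProduct P Q * M := by
  let L : SuperOp N →L[ℝ] SuperOp N := (ContinuousLinearMap.mul ℝ (SuperOp N)).flip M
  have hint := W.measure.clm_apply_integral (B := ContinuousLinearMap.id ℝ _)
    (B' := ContinuousLinearMap.id ℝ _)
    (ContinuousLinearMap.compL ℝ (SuperOp N) (SuperOp N) (SuperOp N) L) L
    (fun T v => by simp) (W.integrable_mulLeftRight hP hQ)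
  refine Eq.trans ?_ hint.symm
  refine congrArg (fun f => W.measure.integral f _) (funext fun x => ?_)
  ext1 v
  simp [L, Matrix.mul_assoc]

theorem innerProduct_sum_mul {ι : Type*} (s : Finset ι) {P : ℝ → SuperOp N}
    {R : ι → ℝ → SuperOp N} (M : ι → SuperOp N) (hP : P.HasTemperateGrowth)
    (hR : ∀ i ∈ s, (R i).HasTemperateGrowth) :
    W.innerProduct P (fun x => ∑ i ∈ s, R i x * M i) = ∑ i ∈ s, W.innerProduct P (R i) * M i := by
  have hRM : ∀ i ∈ s, (fun x => R i x * M i).HasTemperateGrowth := fun i hi =>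
    (hR i hi).fun_mul (Function.HasTemperateGrowth.const (M i))
  rw [← Finset.sum_congr rfl fun i hi => W.innerProduct_mul (M i) hP (hR i hi)]
  simp only [innerProduct, map_sum]
  exact VectorMeasure.integral_finsetSum s fun i hi => W.integrable_mulLeftRight hP (hRM i hi)

end WeightMatrix

namespace QMC

variable {N : ℕ} {Φ : QMC ℕ N}

/-! ### The matrix polynomials -/

theorem smul_Q (hΦ : Φ.IsNearestNeighbour) (hA : ∀ n, IsUnit (Φ.blockMatrix (n + 1) n)) {n L : ℕ}
    (hL : n + 1 < L) (x : ℝ) :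
    x • Φ.Q n x = ∑ k ∈ Finset.range L, Φ.Q k x * superMatrix N (Φ.toEnd k n) := by
  have hinv : ∀ n, (Φ.blockMatrix (n + 1) n)⁻¹ * Φ.blockMatrix (n + 1) n = 1 := fun n =>
    Matrix.nonsing_inv_mul _ ((Matrix.isUnit_iff_isUnit_det _).1 (hA n))
  have hrange : ∑ k ∈ Finset.range L, Φ.Q k x * superMatrix N (Φ.toEnd k n) =
      ∑ k ∈ Finset.range (n + 2), Φ.Q k x * superMatrix N (Φ.toEnd k n) := by
    refine (Finset.sum_subset (Finset.range_mono hL) fun k _ hk => ?_).symm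
    rw [Finset.mem_range, not_lt] at hk
    rw [hΦ.toEnd_eq_zero (Or.inr hk), map_zero, mul_zero]
  rw [hrange]
  cases n with
  | zero =>
    rw [Finset.sum_range_succ, Finset.sum_range_one, superMatrix_toEnd, superMatrix_toEnd, Q, Q,
      Matrix.mul_assoc, hinv 0, one_mul, mul_one]
    abel
  | succ n =>
    rw [Finset.sum_range_succ, Finset.sum_range_succ, Finset.sum_range_succ,
      Finset.sum_eq_zero fun k hk => ?_]
    · rw [superMatrix_toEnd, superMatrix_toEnd, superMatrix_toEnd, Q, Matrix.mul_assoc,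
        hinv (n + 1), mul_one]
      abel
    · rw [Finset.mem_range] at hk
      rw [hΦ.toEnd_eq_zero (Or.inl (by omega)), map_zero, mul_zero]

theorem pow_smul_Q (hΦ : Φ.IsNearestNeighbour) (hA : ∀ n, IsUnit (Φ.blockMatrix (n + 1) n))
    {n j L : ℕ} (hL : j + n < L) (x : ℝ) :
    x ^ n • Φ.Q j x = ∑ i ∈ Finset.range L, Φ.Q i x * superMatrix N (Φ.power n i j) := by
  induction n generalizing L with
  | zero =>
    rw [Finset.sum_eq_single_of_mem j (Finset.mem_range.2 hL)]
    · simp [power]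
    · intro i _ hij
      simp [power, hij]
  | succ n ih =>
    calc x ^ (n + 1) • Φ.Q j x
        = ∑ k ∈ Finset.range (j + n + 1), (x • Φ.Q k x) * superMatrix N (Φ.power n k j) := by
          rw [pow_succ', mul_smul, ih (L := j + n + 1) (by omega), Finset.smul_sum]
          simp only [Matrix.smul_mul]
      _ = ∑ k ∈ Finset.range (j + n + 1), ∑ i ∈ Finset.range L,
            Φ.Q i x * superMatrix N (Φ.toEnd i k * Φ.power n k j) := by
          refine Finset.sum_congr rfl fun k hk => ?_
          rw [Finset.mem_range] at hk
          rw [smul_Q hΦ hA (L := L) (by omega), Finset.sum_mul]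
          refine Finset.sum_congr rfl fun i _ => ?_
          rw [map_mul, Matrix.mul_assoc]
      _ = _ := by
          rw [Finset.sum_comm]
          refine Finset.sum_congr rfl fun i _ => ?_
          rw [power_succ hΦ (n := n) (j := j) (L := j + n + 1) (Or.inr (by omega)), map_sum,
            Finset.mul_sum]

theorem hasTemperateGrowth_Q (Φ : QMC ℕ N) (n : ℕ) : (Φ.Q n).HasTemperateGrowth := by
  induction n using Nat.twoStepInduction with
  | zero => exact Function.HasTemperateGrowth.const 1
  | one =>
    change Function.HasTemperateGrowth fun x : ℝ =>
      (x • 1 - Φ.blockMatrix 0 0) * (Φ.blockMatrix 1 0)⁻¹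
    fun_prop
  | more n h1 h2 =>
    change Function.HasTemperateGrowth fun x : ℝ =>
      (x • Φ.Q (n + 1) x - Φ.Q (n + 1) x * Φ.blockMatrix (n + 1) (n + 1)
        - Φ.Q n x * Φ.blockMatrix n (n + 1)) * (Φ.blockMatrix (n + 2) (n + 1))⁻¹
    fun_prop

end QMC

theorem WeightMatrix.IsWeightOf.innerProduct_pow {N : ℕ} {W : WeightMatrix N} {Φ : QMC ℕ N}
    (hW : W.IsWeightOf Φ) (hΦ : Φ.IsNearestNeighbour) (n i j : ℕ) :
    W.innerProduct (Φ.Q i) (fun x => x ^ n • Φ.Q j x) =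
      W.innerProduct (Φ.Q i) (Φ.Q i) * superMatrix N (Φ.power n i j) := by
  have hexp : (fun x : ℝ => x ^ n • Φ.Q j x) = fun x => ∑ k ∈ Finset.range (i + j + n + 1),
      Φ.Q k x * superMatrix N (Φ.power n k j) :=
    funext fun x => QMC.pow_smul_Q hΦ hW.isUnit_up (by omega) x
  rw [hexp, W.innerProduct_sum_mul _ _ (Φ.hasTemperateGrowth_Q i)
    (fun k _ => Φ.hasTemperateGrowth_Q k)]
  refine Finset.sum_eq_single_of_mem i (Finset.mem_range.2 (by omega)) fun k _ hk => ?_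
  rw [hW.orthogonal i k (Ne.symm hk), zero_mul]

namespace WeightMatrix

variable {N : ℕ} (W : WeightMatrix N)

/-! ### The support of a weight matrix with bounded moments -/

/-- The real part of the trace, as a real functional. -/
noncomputable def reTrace (N : ℕ) : SuperOp N →L[ℝ] ℝ :=
  LinearMap.toContinuousLinearMap
    (Complex.reLm ∘ₗ (Matrix.traceLinearMap (Fin N × Fin N) ℂ ℂ).restrictScalars ℝ)

theorem reTrace_apply (M : SuperOp N) : reTrace N M = M.trace.re := rfl

theorem reTrace_measure_nonneg (s : Set ℝ) : 0 ≤ reTrace N (W.measure s) := by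
  by_cases hs : MeasurableSet s
  · exact (Complex.le_def.1 (W.posSemidef s hs).trace_nonneg).1
  · rw [W.measure.not_measurable hs, map_zero]

theorem reTrace_integral_nonneg {f : ℝ → ℝ} (hf : W.measure.Integrable f) (h0 : ∀ x, 0 ≤ f x) :
    0 ≤ reTrace N (W.measure.integral f (ContinuousLinearMap.lsmul ℝ ℝ)) := by
  rw [W.measure.clm_apply_integral (B' := (ContinuousLinearMap.compL ℝ (SuperOp N) (SuperOp N) ℝ
    (reTrace N)) ∘L ContinuousLinearMap.lsmul ℝ ℝ) (ContinuousLinearMap.id ℝ ℝ) (reTrace N)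
    (fun _ _ => rfl) hf]
  refine setToFun_nonneg _ (fun s _ _ r hr => ?_) (Eventually.of_forall h0)
  change 0 ≤ reTrace N (r • W.measure s)
  rw [map_smul]
  exact mul_nonneg hr (W.reTrace_measure_nonneg s)

/-- A version of Markov's inequality for the moments of a weight matrix. -/
theorem pow_mul_reTrace_measure_le {c : ℝ} (hc : 0 ≤ c) (n : ℕ) :
    c ^ (2 * n) * reTrace N (W.measure {x | c ≤ |x|}) ≤
      reTrace N (W.measure.integral (fun x => x ^ (2 * n)) (ContinuousLinearMap.lsmul ℝ ℝ)) := by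
  have hs : MeasurableSet {x : ℝ | c ≤ |x|} := measurableSet_le measurable_const measurable_norm
  have hind : W.measure.Integrable ({x : ℝ | c ≤ |x|}.indicator fun _ => c ^ (2 * n)) :=
    (integrable_const _).indicator hs
  have hpos := W.reTrace_integral_nonneg ((W.integrable_pow (2 * n)).sub hind) fun x => by
    have hx : x ^ (2 * n) = |x| ^ (2 * n) := by rw [pow_mul, pow_mul, sq_abs]
    simp only [Pi.sub_apply, Set.indicator_apply, Set.mem_ofPred_eq]
    split_ifs with h
    · rw [hx]
      exact sub_nonneg.2 (pow_le_pow_left₀ hc h _)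
    · rw [hx, sub_zero]
      positivity
  rw [VectorMeasure.integral_sub (W.integrable_pow (2 * n)) hind, map_sub, sub_nonneg] at hpos
  refine le_of_eq_of_le ?_ hpos
  rw [VectorMeasure.integral, setToFun_indicator_const _ hs (measure_ne_top _ _)]
  change _ = reTrace N (c ^ (2 * n) • W.measure _)
  rw [map_smul, smul_eq_mul]

/-- By positivity the trace dominates: where it vanishes on `s`, the measure vanishes on every
measurable subset of `s`. -/
theorem variation_eq_zero_of_reTrace_nonpos {s : Set ℝ} (hs : MeasurableSet s)
    (h : reTrace N (W.measure s) ≤ 0) : W.measure.variation s = 0 := by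
  rw [VectorMeasure.variation_apply_eq_zero hs]
  intro t hts ht
  have hsplit : W.measure s = W.measure t + W.measure (s \ t) :=
    (VectorMeasure.of_add_of_sdiff ht hs hts).symm
  rw [hsplit, map_add] at h
  have ht0 : reTrace N (W.measure t) = 0 :=
    le_antisymm (by linarith [W.reTrace_measure_nonneg (s \ t)]) (W.reTrace_measure_nonneg t)
  rw [← (W.posSemidef t ht).trace_eq_zero_iff]
  exact Complex.ext ht0 (Complex.le_def.1 (W.posSemidef t ht).trace_nonneg).2.symm

/-- A weight matrix with bounded moments lives on `[-1, 1]`. -/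
theorem ae_abs_le_one {C : ℝ}
    (hC : ∀ n, reTrace N (W.measure.integral (fun x => x ^ (2 * n))
      (ContinuousLinearMap.lsmul ℝ ℝ)) ≤ C) :
    ∀ᵐ x ∂W.measure.variation, |x| ≤ 1 := by
  have hzero : ∀ c : ℝ, 1 < c → W.measure.variation {x | c ≤ |x|} = 0 := by
    intro c hc
    refine W.variation_eq_zero_of_reTrace_nonpos
      (measurableSet_le measurable_const measurable_norm) ?_
    by_contra! hpos
    -- The powers of `c > 1` are unbounded, but the moments are not.
    obtain ⟨n, hn⟩ := pow_unbounded_of_one_lt (C / reTrace N (W.measure {x | c ≤ |x|})) hc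
    rw [div_lt_iff₀ hpos] at hn
    have hle : c ^ n ≤ c ^ (2 * n) := pow_le_pow_right₀ hc.le (by omega)
    have := (W.pow_mul_reTrace_measure_le (zero_le_one.trans hc.le) n).trans (hC n)
    nlinarith [mul_le_mul_of_nonneg_right hle hpos.le]
  have hall : ∀ᵐ x ∂W.measure.variation, ∀ n : ℕ, ¬ (1 + 1 / ((n : ℝ) + 1) ≤ |x|) := by
    rw [ae_all_iff]
    intro n
    have hn : (1 : ℝ) < 1 + 1 / ((n : ℝ) + 1) := lt_add_of_pos_right _ (by positivity)
    rw [ae_iff]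
    simpa only [not_not] using hzero _ hn
  filter_upwards [hall] with x hx
  by_contra! h
  obtain ⟨n, hn⟩ := exists_nat_one_div_lt (sub_pos.2 h)
  exact hx n (by linarith)

/-! ### Recovering the jumps from the moments -/

theorem innerProduct_one_smul_one {f : ℝ → ℝ} (hf : W.measure.Integrable f) :
    W.innerProduct (fun _ => 1) (fun x => f x • 1) =
      W.measure.integral f (ContinuousLinearMap.lsmul ℝ ℝ) := by
  have hint := W.measure.clm_apply_integral (B := ContinuousLinearMap.lsmul ℝ ℝ)
    (B' := ContinuousLinearMap.id ℝ (SuperOp N →L[ℝ] SuperOp N))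
    (ContinuousLinearMap.toSpanSingleton ℝ (ContinuousLinearMap.id ℝ (SuperOp N)))
    (ContinuousLinearMap.id ℝ (SuperOp N)) (fun r M => by simp) hf
  refine Eq.trans ?_ hint.symm
  refine congrArg (fun g => W.measure.integral g _) (funext fun x => ?_)
  ext1 v
  simp

theorem innerProduct_smul_add_smul {P Q R : ℝ → SuperOp N} (a b : ℝ) (hP : P.HasTemperateGrowth)
    (hQ : Q.HasTemperateGrowth) (hR : R.HasTemperateGrowth) :
    W.innerProduct P (fun x => a • Q x + b • R x) =
      a • W.innerProduct P Q + b • W.innerProduct P R := by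
  simp only [innerProduct, map_add, map_smul]
  rw [VectorMeasure.integral_fun_add ((W.integrable_mulLeftRight hP hQ).fun_smul a)
    ((W.integrable_mulLeftRight hP hR).fun_smul b), VectorMeasure.integral_fun_smul,
    VectorMeasure.integral_fun_smul]

/-- For `y ∈ [-1, 1]`, the sequence `(y^n + y^{n+1}) / 2` converges to the indicator of `1`. The
factor `1 + y` removes the oscillation at `y = -1`. -/
theorem _root_.tendsto_pow_add_pow_succ_div_two {y : ℝ} (hy : |y| ≤ 1) :
    Tendsto (fun n : ℕ => (y ^ n + y ^ (n + 1)) / 2) atTop (𝓝 (if y = 1 then 1 else 0)) := by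
  rcases eq_or_ne y 1 with rfl | h1
  · simp
  rw [if_neg h1]
  rcases eq_or_ne y (-1) with rfl | h2
  · simp [pow_succ]
  have hlt : |y| < 1 := lt_of_le_of_ne hy fun h => by
    rcases eq_or_eq_neg_of_abs_eq h with h | h <;> contradiction
  have h := tendsto_pow_atTop_nhds_zero_of_abs_lt_one hlt
  simpa using (h.add (h.comp (tendsto_add_atTop_nat 1))).div_const 2

theorem tendsto_integral_jump (hsupp : ∀ᵐ x ∂W.measure.variation, |x| ≤ 1) {s : ℝ}
    (hs : s * s = 1) {E G : Type*} [NormedAddCommGroup E] [NormedSpace ℝ E] [NormedAddCommGroup G]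
    [NormedSpace ℝ G] [CompleteSpace G] (B : E →L[ℝ] SuperOp N →L[ℝ] G) {T : ℝ → E}
    (hT : W.measure.Integrable T) :
    Tendsto (fun n : ℕ =>
        W.measure.integral (fun x => (((s * x) ^ n + (s * x) ^ (n + 1)) / 2) • T x) B) atTop
      (𝓝 (B (T s) (W.measure {s}))) := by
  have habs : |s| = 1 := by nlinarith [abs_nonneg s, abs_mul_abs_self s]
  have hjump : W.measure.integral (({s} : Set ℝ).indicator fun _ => T s) B =
      B (T s) (W.measure {s}) := by
    rw [VectorMeasure.integral, setToFun_indicator_const _ (measurableSet_singleton s)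
      (measure_ne_top _ _)]
    rfl
  rw [← hjump]
  refine VectorMeasure.tendsto_integral_of_dominated_convergence (fun x => ‖T x‖) (fun n => ?_)
    hT.norm (fun n => ?_) ?_
  · have hc : Continuous fun x : ℝ => ((s * x) ^ n + (s * x) ^ (n + 1)) / 2 := by fun_prop
    exact hc.aestronglyMeasurable.smul hT.aestronglyMeasurable
  · filter_upwards [hsupp] with x hx
    have hsx : |s * x| ≤ 1 := by rwa [abs_mul, habs, one_mul]
    have hpow : ∀ m : ℕ, |(s * x) ^ m| ≤ 1 := fun m => by
      rw [abs_pow]; exact pow_le_one₀ (abs_nonneg _) hsx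
    rw [norm_smul]
    refine mul_le_of_le_one_left (norm_nonneg _) ?_
    rw [Real.norm_eq_abs, abs_div, abs_two, div_le_one two_pos]
    exact (abs_add_le _ _).trans (by linarith [hpow n, hpow (n + 1)])
  · filter_upwards [hsupp] with x hx
    have hsx : |s * x| ≤ 1 := by rwa [abs_mul, habs, one_mul]
    have hiff : s * x = 1 ↔ x = s :=
      ⟨fun h => by linear_combination s * h - x * hs, fun h => by rw [h, hs]⟩
    have hlim := (tendsto_pow_add_pow_succ_div_two hsx).smul_const (T x)
    convert hlim using 2
    by_cases hxs : x = s
    · rw [if_pos (hiff.2 hxs), hxs]; simp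
    · rw [if_neg fun h => hxs (hiff.1 h)]; simp [hxs]

/-- For a weight matrix on `[-1, 1]`, the jump at `s = ±1` is a limit of moments. -/
theorem tendsto_innerProduct_jump (hsupp : ∀ᵐ x ∂W.measure.variation, |x| ≤ 1) {s : ℝ}
    (hs : s * s = 1) {P Q : ℝ → SuperOp N} (hP : P.HasTemperateGrowth)
    (hQ : Q.HasTemperateGrowth) :
    Tendsto (fun n : ℕ => (s ^ n / 2) • W.innerProduct P (fun x => x ^ n • Q x) +
        (s ^ (n + 1) / 2) • W.innerProduct P (fun x => x ^ (n + 1) • Q x)) atTop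
      (𝓝 ((P s).conjTranspose * W.measure {s} * Q s)) := by
  have hlim := W.tendsto_integral_jump hsupp hs (ContinuousLinearMap.id ℝ _)
    (W.integrable_mulLeftRight hP hQ)
  refine (hlim.congr fun n => ?_)
  rw [← W.innerProduct_smul_add_smul _ _ hP (by fun_prop) (by fun_prop)]
  refine congrArg (fun g => W.measure.integral g _) (funext fun x => ?_)
  simp only [← map_smul, smul_smul, ← add_smul]
  congr 2
  ring

end WeightMatrix

/-! ### Limits of the powers of the chain -/

namespace WeightMatrix

variable {N : ℕ} {W : WeightMatrix N} {Φ : QMC ℕ N}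

theorem IsWeightOf.integral_pow (hW : W.IsWeightOf Φ) (hΦ : Φ.IsNearestNeighbour) (n : ℕ) :
    W.measure.integral (fun x => x ^ n) (ContinuousLinearMap.lsmul ℝ ℝ) =
      W.innerProduct (Φ.Q 0) (Φ.Q 0) * superMatrix N (Φ.power n 0 0) := by
  rw [← W.innerProduct_one_smul_one (W.integrable_pow n), ← hW.innerProduct_pow hΦ n 0 0]
  rfl

theorem IsWeightOf.ae_abs_le_one (hW : W.IsWeightOf Φ) (hΦ : Φ.IsNearestNeighbour) :
    ∀ᵐ x ∂W.measure.variation, |x| ≤ 1 := by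
  obtain ⟨C, hC⟩ := QMC.exists_norm_power_le hΦ 0 0
  refine W.ae_abs_le_one (C := ‖reTrace N‖ * (‖W.innerProduct (Φ.Q 0) (Φ.Q 0)‖ * C)) fun n => ?_
  rw [hW.integral_pow hΦ]
  refine (le_abs_self _).trans (((reTrace N).le_opNorm _).trans ?_)
  gcongr
  exact (norm_mul_le _ _).trans (mul_le_mul_of_nonneg_left (hC _) (norm_nonneg _))

/-- The linear map `F_i⁻¹ Q_i(s)^* W({s}) Q_j(s)` on `M_N(ℂ)`, where `F_i` is the norm of `Q_i`. For
`s = ±1` it is the limit of the averages `(s^n (Φ^n)_{ij} + s^{n+1} (Φ^{n+1})_{ij}) / 2`. -/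
noncomputable def jumpMap (W : WeightMatrix N) (Φ : QMC ℕ N) (s : ℝ) (i j : ℕ) :
    Module.End ℂ (Op N) :=
  (superMatrix N).symm ((W.innerProduct (Φ.Q i) (Φ.Q i))⁻¹ *
    ((Φ.Q i s).conjTranspose * W.measure {s} * Φ.Q j s))

theorem jumpMap_eq_zero {s : ℝ} (h : W.measure {s} = 0) (i j : ℕ) : W.jumpMap Φ s i j = 0 := by
  simp [jumpMap, h]

theorem IsWeightOf.measure_eq_zero_of_jumpMap (hW : W.IsWeightOf Φ) {s : ℝ}
    (h : W.jumpMap Φ s 0 0 = 0) : W.measure {s} = 0 := by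
  have hQ : Φ.Q 0 s = 1 := rfl
  have hF : W.innerProduct (Φ.Q 0) (Φ.Q 0) * (W.innerProduct (Φ.Q 0) (Φ.Q 0))⁻¹ = 1 :=
    Matrix.mul_nonsing_inv _ ((Matrix.isUnit_iff_isUnit_det _).1 (hW.isUnit_norm 0))
  rw [jumpMap, hQ, Matrix.conjTranspose_one, one_mul, mul_one, EmbeddingLike.map_eq_zero_iff] at h
  rw [← one_mul (W.measure {s}), ← hF, Matrix.mul_assoc, h, mul_zero]

theorem IsWeightOf.tendsto_power (hW : W.IsWeightOf Φ) (hΦ : Φ.IsNearestNeighbour) {s : ℝ}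
    (hs : s * s = 1) (i j : ℕ) (X : Op N) :
    Tendsto (fun n : ℕ => (s ^ n / 2) • Φ.power n i j X +
      (s ^ (n + 1) / 2) • Φ.power (n + 1) i j X) atTop (𝓝 (W.jumpMap Φ s i j X)) := by
  set F := W.innerProduct (Φ.Q i) (Φ.Q i) with hF
  have hinv : F⁻¹ * F = 1 :=
    Matrix.nonsing_inv_mul _ ((Matrix.isUnit_iff_isUnit_det _).1 (hW.isUnit_norm i))
  have hlim := (W.tendsto_innerProduct_jump (hW.ae_abs_le_one hΦ) hs (Φ.hasTemperateGrowth_Q i)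
    (Φ.hasTemperateGrowth_Q j)).const_mul F⁻¹
  refine (tendsto_superMatrix_symm_apply hlim X).congr fun n => ?_
  simp only [hW.innerProduct_pow hΦ, ← hF, mul_add, mul_smul_comm, ← Matrix.mul_assoc, hinv,
    one_mul, map_add, LinearMap.add_apply]
  have hsmul : ∀ (r : ℝ) (f : Module.End ℂ (Op N)),
      (superMatrix N).symm (r • superMatrix N f) X = r • f X := fun r f => by
    have h := LinearMap.congr_fun
      ((superMatrix N).symm.toLinearMap.map_smul_of_tower r (superMatrix N f)) X
    refine h.trans ?_
    change r • (superMatrix N).symm (superMatrix N f) X = r • f X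
    rw [AlgEquiv.symm_apply_apply]
  rw [hsmul, hsmul]

end WeightMatrix

namespace QMC

variable {N : ℕ} {W : WeightMatrix N} {Φ : QMC ℕ N}

/-! ### Invariant densities and jumps -/

/-- The averages of two consecutive powers, applied to an invariant density, would tend to zero if
`W` had no jump at `1`. -/
theorem hasJumpAt_one_of_invariant (hΦ : Φ.IsNearestNeighbour) (hW : W.IsWeightOf Φ)
    {ρ : ℕ → Op N} (hρ : IsDensity ρ) (hinv : Φ.evolve ρ = ρ) : W.HasJumpAt 1 := by
  intro hjump
  have hρ0 : ∀ j, 0 ≤ ρ j := fun j => Matrix.nonneg_iff_posSemidef.2 (hρ.1 j)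
  have hnorm : ∀ n i j, ‖(Φ.power n i j (ρ j)).trace‖ ≤ ‖(ρ j).trace‖ := fun n i j =>
    CStarAlgebra.norm_le_norm_of_nonneg_of_le
      (ha := (Matrix.nonneg_iff_posSemidef.1 (power_nonneg n i j (hρ0 j))).trace_nonneg)
      (trace_power_le hΦ n i j (hρ0 j))
  have hsum : ∀ n i, HasSum (fun j => (Φ.power n i j (ρ j)).trace) (ρ i).trace := by
    intro n i
    rw [← sum_power_of_evolve_eq hΦ hinv (Nat.lt_succ_self (i + n)), Matrix.trace_sum]
    refine hasSum_sum_of_ne_finset_zero fun j hj => ?_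
    rw [Finset.mem_range, not_lt] at hj
    rw [power_eq_zero hΦ (Or.inl hj), LinearMap.zero_apply, Matrix.trace_zero]
  have htrace : ∀ i, (ρ i).trace = 0 := by
    intro i
    have hlim : Tendsto (fun n : ℕ => ∑' j, ((Φ.power n i j (ρ j)).trace / 2 +
        (Φ.power (n + 1) i j (ρ j)).trace / 2)) atTop (𝓝 (∑' _ : ℕ, (0 : ℂ))) := by
      refine tendsto_tsum_of_dominated_convergence (bound := fun j => ‖(ρ j).trace‖)
        hρ.2.summable.norm (fun j => ?_) (Eventually.of_forall fun n j => ?_)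
      · have h := hW.tendsto_power hΦ (one_mul 1) i j (ρ j)
        rw [WeightMatrix.jumpMap_eq_zero hjump, LinearMap.zero_apply] at h
        have h2 := ((continuous_id.matrix_trace).tendsto (0 : Op N)).comp h
        simp only [id, Matrix.trace_zero] at h2
        refine h2.congr fun n => ?_
        simp [Matrix.trace_add, Matrix.trace_smul, div_eq_inv_mul]
      · refine (norm_add_le _ _).trans ?_
        rw [norm_div, norm_div, Complex.norm_ofNat]
        linarith [hnorm n i j, hnorm (n + 1) i j]
    have hconst : ∀ n : ℕ, ∑' j, ((Φ.power n i j (ρ j)).trace / 2 +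
        (Φ.power (n + 1) i j (ρ j)).trace / 2) = (ρ i).trace := fun n => by
      rw [(((hsum n i).div_const 2).add ((hsum (n + 1) i).div_const 2)).tsum_eq, add_halves]
    simp only [hconst, tsum_zero] at hlim
    exact tendsto_nhds_unique tendsto_const_nhds hlim
  have h1 := hρ.2
  simp only [htrace] at h1
  exact zero_ne_one (hasSum_zero.unique h1)

/-- Positive summable invariant blocks that are not all zero can be normalised to an invariant
density. -/
theorem exists_invariant_density (hΦ : Φ.IsNearestNeighbour) {σ : ℕ → Op N} (h0 : ∀ i, 0 ≤ σ i)
    (hsum : Summable fun i => (σ i).trace.re) (hinv : Φ.evolve σ = σ) {i₀ : ℕ} (hne : σ i₀ ≠ 0) :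
    ∃ ρ : ℕ → Op N, IsDensity ρ ∧ Φ.evolve ρ = ρ := by
  have hpos : ∀ i, 0 ≤ (σ i).trace := fun i =>
    (Matrix.nonneg_iff_posSemidef.1 (h0 i)).trace_nonneg
  have hre : ∀ i, (σ i).trace = ((σ i).trace.re : ℂ) := fun i =>
    Complex.ext rfl (Complex.le_def.1 (hpos i)).2.symm
  have hi₀ : 0 < (σ i₀).trace.re := by
    refine lt_of_le_of_ne (Complex.le_def.1 (hpos i₀)).1 fun h => hne ?_
    rw [← (Matrix.nonneg_iff_posSemidef.1 (h0 i₀)).trace_eq_zero_iff, hre, ← h, Complex.ofReal_zero]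
  set c : ℝ := ∑' i, (σ i).trace.re
  have hc : 0 < c := hsum.tsum_pos (fun i => (Complex.le_def.1 (hpos i)).1) i₀ hi₀
  refine ⟨fun i => ((c : ℂ)⁻¹) • σ i, ⟨fun i => ?_, ?_⟩, ?_⟩
  · refine (Matrix.nonneg_iff_posSemidef.1 (h0 i)).smul ?_
    rw [← Complex.ofReal_inv]
    exact Complex.zero_le_real.2 (inv_nonneg.2 hc.le)
  · have h := (Complex.hasSum_ofReal.2 hsum.hasSum).mul_left ((c : ℂ)⁻¹)
    rw [inv_mul_cancel₀ (Complex.ofReal_ne_zero.2 hc.ne')] at h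
    refine h.congr_fun fun i => ?_
    rw [Matrix.trace_smul, smul_eq_mul, ← hre]
  · funext i
    have hi := congrFun hinv i
    rw [evolve_eq_sum hΦ _ (Nat.lt_succ_self (i + 1))] at hi ⊢
    simp only [map_smul, ← Finset.smul_sum, hi]

/-- A jump at `1` makes the averages of two consecutive powers, started from a positive operator
at the site `0`, converge to a nonzero invariant limit. -/
theorem exists_invariant_density_of_hasJumpAt_one (hΦ : Φ.IsNearestNeighbour)
    (hW : W.IsWeightOf Φ) (hjump : W.HasJumpAt 1) :
    ∃ ρ : ℕ → Op N, IsDensity ρ ∧ Φ.evolve ρ = ρ := by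
  obtain ⟨X, hX, hne⟩ : ∃ X : Op N, 0 ≤ X ∧ W.jumpMap Φ 1 0 0 X ≠ 0 := by
    by_contra! h
    exact hjump (hW.measure_eq_zero_of_jumpMap (LinearMap.eq_zero_of_nonneg h))
  set a : ℕ → ℕ → Op N := fun n i => (1 / 2 : ℝ) • Φ.power n i 0 X +
    (1 / 2 : ℝ) • Φ.power (n + 1) i 0 X with ha
  have hlim : ∀ i, Tendsto (fun n => a n i) atTop (𝓝 (W.jumpMap Φ 1 i 0 X)) := fun i => by
    simpa only [one_pow] using hW.tendsto_power hΦ (one_mul 1) i 0 X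
  have htr : ∀ Y Z : Op N, ((1 / 2 : ℝ) • Y + (1 / 2 : ℝ) • Z).trace.re =
      (Y.trace.re + Z.trace.re) / 2 := fun Y Z => by
    simp [Matrix.trace_add, Matrix.trace_smul]
    ring
  have ha0 : ∀ n i, 0 ≤ a n i := fun n i =>
    add_nonneg (smul_nonneg (by norm_num) (power_nonneg n i 0 hX))
      (smul_nonneg (by norm_num) (power_nonneg (n + 1) i 0 hX))
  have hσ0 : ∀ i, 0 ≤ W.jumpMap Φ 1 i 0 X := fun i =>
    ge_of_tendsto' (hlim i) fun n => ha0 n i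
  refine exists_invariant_density hΦ hσ0 ?_ ?_ hne
  -- Mass may be lost in the limit, but the traces of the limit are still summable.
  · refine summable_of_sum_le (c := X.trace.re)
      (fun i => (Complex.le_def.1 (Matrix.nonneg_iff_posSemidef.1 (hσ0 i)).trace_nonneg).1)
      fun s => ?_
    have hcont : Continuous fun Y : Op N => Y.trace.re :=
      Complex.continuous_re.comp continuous_id.matrix_trace
    refine le_of_tendsto' (tendsto_finsetSum s fun i _ => (hcont.tendsto _).comp (hlim i))
      fun n => ?_
    simp only [Function.comp_apply, ha, htr, ← Finset.sum_div, Finset.sum_add_distrib]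
    have h := fun m => (Complex.le_def.1 (sum_trace_power_le hΦ m 0 s hX)).1
    simp only [Complex.re_sum] at h
    linarith [h n, h (n + 1)]
  · funext i
    rw [evolve_eq_sum hΦ _ (Nat.lt_succ_self (i + 1))]
    have hstep : ∀ n, a (n + 1) i = ∑ k ∈ Finset.range (i + 2), Φ.toEnd i k (a n k) := fun n => by
      simp only [ha, power_succ hΦ (i := i) (L := i + 2) (Or.inl (Nat.lt_succ_self _)),
        LinearMap.sum_apply, Module.End.mul_apply, map_add, Finset.sum_add_distrib,
        Finset.smul_sum, LinearMap.map_smul_of_tower]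
    -- Both sides are limits of the site `i` of the `(n + 1)`-st average.
    refine tendsto_nhds_unique (tendsto_finsetSum _ fun k _ => ?_)
      (((hlim i).comp (tendsto_add_atTop_nat 1)).congr hstep)
    exact ((Φ.toEnd i k).continuous_of_finiteDimensional.tendsto _).comp (hlim k)

/-- If there is no jump at `1`, then `(Φ^{2n})_{00}` and `-(Φ^{2n+1})_{00}` have the same limit, so
that this limit and its negative are positive maps. -/
theorem hasJumpAt_one_of_neg_one (hΦ : Φ.IsNearestNeighbour) (hW : W.IsWeightOf Φ)
    (hjump : W.HasJumpAt (-1)) : W.HasJumpAt 1 := by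
  intro h1
  refine hjump (hW.measure_eq_zero_of_jumpMap (LinearMap.eq_zero_of_nonneg fun X hX => ?_))
  have hplus := hW.tendsto_power hΦ (one_mul 1) 0 0 X
  rw [WeightMatrix.jumpMap_eq_zero h1, LinearMap.zero_apply] at hplus
  have hminus := hW.tendsto_power hΦ (show (-1 : ℝ) * -1 = 1 by norm_num) 0 0 X
  have heven : Tendsto (fun n : ℕ => 2 * n) atTop atTop :=
    tendsto_id.const_mul_atTop' two_pos
  have hodd : Tendsto (fun n : ℕ => 2 * n + 1) atTop atTop :=
    (tendsto_add_atTop_nat 1).comp heven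
  have hpow : ∀ n : ℕ, (-1 : ℝ) ^ (2 * n) = 1 := fun n => by simp
  apply le_antisymm
  · have h := (hplus.comp hodd).sub (hminus.comp hodd)
    rw [zero_sub] at h
    refine neg_nonneg.1 (ge_of_tendsto' h fun n => ?_)
    have : 0 ≤ Φ.power (2 * n + 1) 0 0 X := power_nonneg _ _ _ hX
    convert this using 1
    simp only [Function.comp_apply, one_pow, pow_succ, hpow]
    module
  · have h := (hplus.comp heven).add (hminus.comp heven)
    rw [zero_add] at h
    refine ge_of_tendsto' h fun n => ?_
    have : 0 ≤ Φ.power (2 * n) 0 0 X := power_nonneg _ _ _ hX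
    convert this using 1
    simp only [Function.comp_apply, one_pow, pow_succ, hpow]
    module

end QMC

theorem mainTheorem3 (N : ℕ) (hN : 0 < N) (Φ : QMC ℕ N) (hΦ : Φ.IsNearestNeighbour)
    (hirr : Φ.IsIrreducible) (W : WeightMatrix N) (hW : W.IsWeightOf Φ) :
    (Φ.IsPositiveRecurrent ↔ W.HasJumpAt 1) ∧ (W.HasJumpAt (-1) → W.HasJumpAt 1) := by
  refine ⟨⟨?_, fun h => ⟨hirr, ?_⟩⟩, QMC.hasJumpAt_one_of_neg_one hΦ hW⟩
  · rintro ⟨-, ρ, hρ, hinv⟩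
    exact QMC.hasJumpAt_one_of_invariant hΦ hW hρ hinv
  · exact QMC.exists_invariant_density_of_hasJumpAt_one hΦ hW h
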